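/- **Setting.** Let $X\subset\mathbb R^n$ be nonempty, closed and convex, $f:\mathbb R^n\to\mathbb R$ continuous and quasiconvex, $\nu\in\mathbb R$, and $X_\nu:=\{x\in X: f(x)\le\nu\}$. Let $\xi$ be a random vector with distribution $\mathbb P$ supported on $\Xi\subset\mathbb R^d$, let $m\ge 1$ and let $g=(g_1,\dots,g_m):\mathbb R^n\times\mathbb R^d\to\mathbb R^m$ be continuously differentiable. Put $p(x):=\mathbb P\{g(x,\xi)\not\le 0\}$. Let $\phi:\mathbb R\times\mathbb R_+\to\mathbb R$ be a smoothing function with smoothing parameters $\tau_{k,j}$ ($k=0,1,2,\dots$; $j=1,\dots,m$), and put $\phi_{k,j}(y):=\phi(y;\tau_{k,j})$ and $$\hat p_k(x):=\mathbb E\bigl[\max_{1\le j\le m}\phi_{k,j}(g_j(x,\xi))\bigr].$$ Let $\mathbb 1(y)=1$ for $y>0$ and $\mathbb 1(y)=0$ for $y\le0$. For a locally Lipschitz function $h$, $\partial h(x)$ is the Clarke generalized gradient, and $N_{X_\nu}(x)$ is the normal cone to the convex set $X_\nu$ at $x\in X_\nu$. A point $x\in X_\nu$ is a (Clarke) stationary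 point of $\min_{X_\nu}\hat p_k$ if $0\in\partial\hat p_k(x)+N_{X_\nu}(x)$. **Assumptions.** 1. $X_\nu$ is nonempty and compact. 2. For each $j$ and all $\xi\in\Xi$: (a) $g_j(\cdot,\xi)$ is Lipschitz on $X_\nu$ with a measurable constant $L_{g,j}(\xi)\ge0$ satisfying $\mathbb E[L_{g,j}^2(\xi)]<\infty$; moreover, each point of $X_\nu$ has a neighbourhood in $\mathbb R^n$ on which $g_j(\cdot,\xi)$, $\xi\in\Xi$, is Lipschitz with a $\mathbb P$-integrable constant (so that $\hat p_k$ is locally Lipschitz around the points of $X_\nu$ and $\partial\hat p_k$ is well defined there); (b) $\nabla_x g_j(\cdot,\xi)$ is Lipschitz on $X_\nu$ with a measurable constant $L'_{g,j}(\xi)\ge0$ satisfying $\mathbb E[L'_{g,j}(\xi)]<\infty$; (c) there is $\sigma_{g,j}>0$ with $\mathbb E\|\nabla_xg_j(x,\xi)\|^2\le\sigma_{g,j}^2$ for all $x\in X_\nu$. 3. The functions $\phi_{k,j}$ are continuously differentiable, nondecreasing and uniformly bounded (by one constant for all $k,j$), and $\phi_{k,j}(y)\to\mathbb 1(y)$ as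 $k\to\infty$ for every $y\ne0$. 4. For each $k,j$, the derivative of $\phi_{k,j}$ is bounded and Lipschitz on $\mathbb R$ (with constants that may depend on $k,j$). 5. There is $\tau_c\in(0,1)$ with $\tau_{k+1,j}=\tau_c\,\tau_{k,j}$ and $\tau_{0,j}>0$ for all $k,j$; and $\phi(\lambda y;\lambda z)=\phi(y;z)$ for all $\lambda>0$, $y\in\mathbb R$, $z>0$. 6. Let $F(x,\eta):=\mathbb P\{\max_j g_j(x,\xi)/\tau_{0,j}\le\eta\}$. There are $\theta>0$ and an open set $\bar X\supset X_\nu$ such that $F$ is continuously differentiable on $\bar X\times(-\theta,\theta)$. For each $\eta\in\mathbb R$, $F(\cdot,\eta)$ is Lipschitz on $X_\nu$ with constant $L_F(\eta)\ge0$, where $L_F$ is measurable and $\int_{\mathbb R}L_F(\eta)\,d\eta<\infty$. 7. There are positive numbers $\varepsilon_k\downarrow0$ such that $$\lim_{k\to\infty}\int_{|\eta|\ge\varepsilon_k}L_F(\eta)\,\phi'(\eta;\tau_c^{k})\,d\eta=0,\qquad \lim_{k\to\infty}\bigl(\phi(\varepsilon_k;\tau_c^{k})-\phi(-\varepsilon_k;\tau_c^{k})\bigr)=1,$$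 where $\phi'$ is the derivative in the first argument. **Theorem.** For each $k$ let $x_k$ be a stationary point of $\min_{X_\nu}\hat p_k$. Then every accumulation point $\bar x$ of $(x_k)$ is a stationary point of $\min_{X_\nu}p$: $\bar x\in X_\nu$, $p$ is differentiable at $\bar x$, and $0\in\nabla p(\bar x)+N_{X_\nu}(\bar x)$. -/

import Mathlib

open Filter Topology MeasureTheory Set
open scoped Pointwise

noncomputable section

namespace ChanceSmoothing

/-- Euclidean space `ℝⁿ` with the Euclidean norm. -/
abbrev Euc (n : ℕ) : Type := EuclideanSpace ℝ (Fin n)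

/-! ### Variational analysis -/

/-- Clarke's generalized directional derivative
`f°(x; v) = limsup_{y → x, t ↓ 0} (f (y + t v) - f y) / t`, computed in the extended reals. -/
def clarkeDirDeriv {n : ℕ} (f : Euc n → ℝ) (x v : Euc n) : EReal :=
  limsup (fun q : Euc n × ℝ => (((f (q.1 + q.2 • v) - f q.1) / q.2 : ℝ) : EReal))
    (𝓝 x ×ˢ 𝓝[>] (0 : ℝ))

/-- The Clarke generalized gradient `∂f(x) = {ζ : ⟪ζ, v⟫ ≤ f°(x; v) for all v}`. -/
def clarkeGradient {n : ℕ} (f : Euc n → ℝ) (x : Euc n) : Set (Euc n) :=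
  {ζ | ∀ v : Euc n, ((inner ℝ ζ v : ℝ) : EReal) ≤ clarkeDirDeriv f x v}

/-- The normal cone to a convex set `S` at `x` (empty if `x ∉ S`). -/
def normalCone {n : ℕ} (S : Set (Euc n)) (x : Euc n) : Set (Euc n) :=
  {w | x ∈ S ∧ ∀ y ∈ S, inner ℝ w (y - x) ≤ 0}

/-- `x` is a (Clarke) stationary solution of `min_{S} f`, for `S` convex:
`0 ∈ ∂f(x) + N_S(x)`. -/
def IsClarkeStationary {n : ℕ} (f : Euc n → ℝ) (S : Set (Euc n)) (x : Euc n) : Prop :=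
  x ∈ S ∧ (0 : Euc n) ∈ clarkeGradient f x + normalCone S x

/-! ### The problem data -/

/-- `X_ν = {x ∈ X : f x ≤ ν}`. -/
def feasibleSet {n : ℕ} (X : Set (Euc n)) (f : Euc n → ℝ) (ν : ℝ) : Set (Euc n) :=
  {x | x ∈ X ∧ f x ≤ ν}

/-- The lower semicontinuous step function. -/
def step (z : ℝ) : ℝ := if 0 < z then 1 else 0

/-- The probability of constraint violation `p(x) = ℙ{g(x, ξ) ≰ 0}`. -/
def violationProb {n d m : ℕ} (P : Measure (Euc d)) (g : Fin m → Euc n → Euc d → ℝ)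
    (x : Euc n) : ℝ :=
  P.real {ξ | ¬ ∀ j, g j x ξ ≤ 0}

/-- The smoothing functions `φ_{k,j}(y) = φ(y; τ_{k,j})`. -/
def smoothing {m : ℕ} (φ : ℝ → ℝ → ℝ) (τ : ℕ → Fin m → ℝ) (k : ℕ) (j : Fin m) (y : ℝ) : ℝ :=
  φ y (τ k j)

/-- The approximation `p̂_k(x) = 𝔼[max_j φ_{k,j}(g_j(x, ξ))]`. -/
def approxProb {n d m : ℕ} (P : Measure (Euc d)) (g : Fin m → Euc n → Euc d → ℝ)
    (φ : ℝ → ℝ → ℝ) (τ : ℕ → Fin m → ℝ) (k : ℕ) (x : Euc n) : ℝ :=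
  ∫ ξ, (⨆ j : Fin m, smoothing φ τ k j (g j x ξ)) ∂P

/-- The cumulative distribution function `F(x, η) = ℙ{max_j g_j(x, ξ) / τ_{0,j} ≤ η}` of the
scaled max-constraint (the sequence of smoothing parameters starts at the index `0`). -/
def scaledCDF {n d m : ℕ} (P : Measure (Euc d)) (g : Fin m → Euc n → Euc d → ℝ)
    (τ : ℕ → Fin m → ℝ) (x : Euc n) (η : ℝ) : ℝ :=
  P.real {ξ | (⨆ j : Fin m, g j x ξ / τ 0 j) ≤ η}

/-! ### The assumptions -/

/-- Lipschitz and moment conditions on the constraint functions over `S` (the set `X_ν`). -/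
structure ConstraintRegularity {n d m : ℕ} (P : Measure (Euc d)) (Ξ : Set (Euc d))
    (g : Fin m → Euc n → Euc d → ℝ) (S : Set (Euc n)) : Prop where
  /-- `g_j(·, ξ)` is Lipschitz on `S` with a square-integrable constant. -/
  lipschitz : ∀ j, ∃ L : Euc d → ℝ, Measurable L ∧ (∀ ξ, 0 ≤ L ξ) ∧
    Integrable (fun ξ => L ξ ^ 2) P ∧
    ∀ ξ ∈ Ξ, ∀ x ∈ S, ∀ y ∈ S, |g j x ξ - g j y ξ| ≤ L ξ * ‖x - y‖
  /-- Near each point of `S`, also off `S`, `g_j(·, ξ)` is Lipschitz with an integrable constant,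
  so that the approximations are locally Lipschitz around the points of `S`. -/
  locallyLipschitz : ∀ j, ∀ x₀ ∈ S, ∃ U ∈ 𝓝 x₀, ∃ L : Euc d → ℝ, Integrable L P ∧
    ∀ ξ ∈ Ξ, ∀ x ∈ U, ∀ y ∈ U, |g j x ξ - g j y ξ| ≤ L ξ * ‖x - y‖
  /-- `∇g_j(·, ξ)` is Lipschitz on `S` with an integrable constant. -/
  gradient_lipschitz : ∀ j, ∃ L : Euc d → ℝ, Measurable L ∧ (∀ ξ, 0 ≤ L ξ) ∧ Integrable L P ∧
    ∀ ξ ∈ Ξ, ∀ x ∈ S, ∀ y ∈ S,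
      ‖gradient (fun z => g j z ξ) x - gradient (fun z => g j z ξ) y‖ ≤ L ξ * ‖x - y‖
  /-- The second moments of the gradients are bounded on `S`. -/
  gradient_moment : ∀ j, ∃ σ : ℝ, 0 < σ ∧ ∀ x ∈ S,
    Integrable (fun ξ => ‖gradient (fun z => g j z ξ) x‖ ^ 2) P ∧
    ∫ ξ, ‖gradient (fun z => g j z ξ) x‖ ^ 2 ∂P ≤ σ ^ 2

/-- Basic conditions on the smoothing functions `φ_{k,j}`. -/
structure SmoothingBasic {m : ℕ} (φk : ℕ → Fin m → ℝ → ℝ) : Prop where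
  contDiff : ∀ k j, ContDiff ℝ 1 (φk k j)
  monotone : ∀ k j, Monotone (φk k j)
  equibounded : ∃ M : ℝ, 0 < M ∧ ∀ k j y, |φk k j y| ≤ M
  tendsto_step : ∀ j, ∀ y : ℝ, y ≠ 0 → Tendsto (fun k => φk k j y) atTop (𝓝 (step y))

/-- The derivatives of the smoothing functions are bounded and Lipschitz, with constants that may
depend on `k` and `j`. -/
structure SmoothingDerivatives {m : ℕ} (φk : ℕ → Fin m → ℝ → ℝ) : Prop where
  bounded : ∀ k j, ∃ M : ℝ, ∀ y, |deriv (φk k j) y| ≤ M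
  lipschitz : ∀ k j, ∃ L : ℝ, 0 ≤ L ∧
    ∀ y z, |deriv (φk k j) y - deriv (φk k j) z| ≤ L * |y - z|

/-- The smoothing parameters form geometric sequences with common ratio `τc ∈ (0, 1)`, and `φ` is
homogeneous of degree zero. -/
structure GeometricSmoothing {m : ℕ} (φ : ℝ → ℝ → ℝ) (τ : ℕ → Fin m → ℝ) (τc : ℝ) : Prop where
  ratio_mem : τc ∈ Ioo (0 : ℝ) 1
  init_pos : ∀ j, 0 < τ 0 j
  step_eq : ∀ k j, τ (k + 1) j = τc * τ k j
  homogeneous : ∀ l y z : ℝ, 0 < l → 0 < z → φ (l * y) (l * z) = φ y z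

/-- The distribution function `F` is continuously differentiable around `S × {0}`, and `F(·, η)` is
Lipschitz on `S` with constant `LF η`, where `LF` is Lebesgue integrable. -/
structure CDFRegularity {n : ℕ} (F : Euc n → ℝ → ℝ) (S : Set (Euc n)) (LF : ℝ → ℝ) : Prop where
  contDiffOn : ∃ θ : ℝ, 0 < θ ∧ ∃ Xbar : Set (Euc n), IsOpen Xbar ∧ S ⊆ Xbar ∧
    ContDiffOn ℝ 1 (fun q : Euc n × ℝ => F q.1 q.2) (Xbar ×ˢ Ioo (-θ) θ)
  measurable : Measurable LF
  nonneg : ∀ η, 0 ≤ LF η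
  integrable : Integrable LF volume
  lipschitz : ∀ η, ∀ x ∈ S, ∀ y ∈ S, |F x η - F y η| ≤ LF η * ‖x - y‖

/-- The tail condition that links the Lipschitz modulus `LF` with the smoothing functions
`φ(·; τc ^ k)`, `k = 0, 1, 2, …`. -/
def TailCondition (φ : ℝ → ℝ → ℝ) (τc : ℝ) (LF : ℝ → ℝ) : Prop :=
  ∃ ε : ℕ → ℝ, (∀ k, 0 < ε k) ∧ Antitone ε ∧ Tendsto ε atTop (𝓝 0) ∧
    Tendsto (fun k => ∫ η in {η : ℝ | ε k ≤ |η|}, LF η * deriv (fun y => φ y (τc ^ k)) η)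
      atTop (𝓝 0) ∧
    Tendsto (fun k => φ (ε k) (τc ^ k) - φ (-ε k) (τc ^ k)) atTop (𝓝 1)

end ChanceSmoothing

end

/-!
Write `ψ k = φ(·; τc ^ k)` and let `G(x, ξ) = max_j g_j(x, ξ) / τ_{0,j}` be the scaled
max-constraint, with distribution function `F(x, ·)`. Homogeneity of `φ` and monotonicity give
`p̂_k(x) = 𝔼[ψ k (G(x, ξ))]`, and Fubini's theorem turns this into `c - ∫ F(x, η) (ψ k)'(η) dη`
(`exists_forall_integral_comp_eq`, `approxProb_sub_approxProb`).

The assumptions control `F(·, η)` for large `|η|` only on the feasible set `S`, whereas the Clarke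
gradient of `p̂_k` looks at all points near `x_k`. The gap is closed by regularity: the integrand of
`p̂_k` is a maximum of finitely many `C¹` functions, so that its generalized and ordinary directional
derivatives agree, and dominated convergence carries this over to the expectation
(`exists_hasRegularDirDeriv_iSup`, `HasRegularDirDeriv.integral`). Hence stationarity of `x_k` says
that the ordinary directional derivatives of `p̂_k` at `x_k` along segments inside the convex set `S`
are nonnegative.

For `y ∈ S` the directional derivative along `y - x_k` is then bounded above
(`dirDeriv_approxProb_le`) by splitting the integral of the increments of `F` against `(ψ k)'`. The
part with `|η| ≥ ε_k` is at most `‖y - x_k‖ ∫ L_F (ψ k)'`, which vanishes in the limit. On the window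
`|η| < ε_k`, whose `(ψ k)'`-mass tends to one, strict differentiability of `F` at `(x̄, 0)` replaces
the increments by `∇_x F(x̄, 0)`. In the limit `0 ≤ -⟪∇_x F(x̄, 0), y - x̄⟫`, which is the claim
since `p = 1 - F(·, 0)`.
-/

namespace ChanceSmoothing

/-! ### Regular directional derivatives -/

/-- `D` is the ordinary one-sided directional derivative of `h` at `x` along `v`, and it dominates
Clarke's generalized directional derivative there. For locally Lipschitz `h`, having this along
all `v` is Clarke regularity at `x`. The bound on the upper limit is expressed by eventual
inequalities, so that it does not presuppose that the difference quotients are bounded. -/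
structure HasRegularDirDeriv {n : ℕ} (h : Euc n → ℝ) (x v : Euc n) (D : ℝ) : Prop where
  tendsto : Tendsto (fun t : ℝ => (h (x + t • v) - h x) / t) (𝓝[>] 0) (𝓝 D)
  eventually_lt : ∀ c, D < c →
    ∀ᶠ q : Euc n × ℝ in 𝓝 x ×ˢ 𝓝[>] (0 : ℝ), (h (q.1 + q.2 • v) - h q.1) / q.2 < c

lemma HasRegularDirDeriv.clarkeDirDeriv_le {n : ℕ} {h : Euc n → ℝ} {x v : Euc n} {D : ℝ}
    (hD : HasRegularDirDeriv h x v D) : clarkeDirDeriv h x v ≤ (D : EReal) := by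
  refine EReal.le_of_forall_lt_iff_le.1 fun c hc => ?_
  refine limsup_le_of_le (by isBoundedDefault) ?_
  filter_upwards [hD.eventually_lt c (EReal.coe_lt_coe_iff.1 hc)] with q hq
  exact EReal.coe_le_coe_iff.2 hq.le

lemma tendsto_add_smul_prod {n : ℕ} (x v : Euc n) :
    Tendsto (fun q : Euc n × ℝ => q.1 + q.2 • v) (𝓝 x ×ˢ 𝓝[>] (0 : ℝ)) (𝓝 x) := by
  have h : Tendsto (fun q : Euc n × ℝ => q.1 + q.2 • v) (𝓝 (x, 0)) (𝓝 (x + (0 : ℝ) • v)) :=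
    Continuous.tendsto (by fun_prop) _
  rw [zero_smul, add_zero, nhds_prod_eq] at h
  exact h.mono_left (prod_mono le_rfl nhdsWithin_le_nhds)

lemma eventually_prod_snd_pos {n : ℕ} (x : Euc n) :
    ∀ᶠ q : Euc n × ℝ in 𝓝 x ×ˢ 𝓝[>] (0 : ℝ), 0 < q.2 :=
  tendsto_snd.eventually (eventually_mem_nhdsWithin (a := (0 : ℝ)) (s := Ioi 0))

lemma eventually_quotient_lt_of_hasStrictFDerivAt {n : ℕ} {h : Euc n → ℝ} {x v : Euc n}
    {h' : Euc n →L[ℝ] ℝ} (hh : HasStrictFDerivAt h h' x) {c : ℝ} (hc : h' v < c) :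
    ∀ᶠ q : Euc n × ℝ in 𝓝 x ×ˢ 𝓝[>] (0 : ℝ), (h (q.1 + q.2 • v) - h q.1) / q.2 < c := by
  have hv : 0 < ‖v‖ + 1 := by positivity
  have he : 0 < (c - h' v) / (‖v‖ + 1) := div_pos (sub_pos.2 hc) hv
  have ht : Tendsto (fun q : Euc n × ℝ => (q.1 + q.2 • v, q.1)) (𝓝 x ×ˢ 𝓝[>] (0 : ℝ))
      (𝓝 (x, x)) := (tendsto_add_smul_prod x v).prodMk_nhds tendsto_fst
  filter_upwards [ht.eventually (hh.isLittleO.def he), eventually_prod_snd_pos x] with q hq hpos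
  simp only [add_sub_cancel_left, map_smul, smul_eq_mul, norm_smul, Real.norm_eq_abs,
    abs_of_pos hpos] at hq
  rw [div_lt_iff₀ hpos]
  have h1 := (abs_le.1 hq).2
  have h2 : (c - h' v) / (‖v‖ + 1) * ‖v‖ < c - h' v := by
    rw [div_mul_eq_mul_div, div_lt_iff₀ hv]
    nlinarith [sub_pos.2 hc]
  nlinarith

/-- A finite maximum of strictly differentiable functions is regular: the index active at the
displaced point is already active at `x`, and the derivative of the maximum is the largest
derivative of an active function. -/
lemma exists_hasRegularDirDeriv_iSup {n : ℕ} {ι : Type*} [Finite ι] [Nonempty ι]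
    {h : ι → Euc n → ℝ} {x : Euc n} {h' : ι → Euc n →L[ℝ] ℝ}
    (hh : ∀ i, HasStrictFDerivAt (h i) (h' i) x) (v : Euc n) :
    ∃ D, HasRegularDirDeriv (fun y => ⨆ i, h i y) x v D := by
  have hle : ∀ i y, h i y ≤ ⨆ i, h i y := fun i y =>
    le_ciSup (f := fun i => h i y) (Set.finite_range _).bddAbove i
  obtain ⟨i₁, hi₁⟩ := exists_eq_ciSup_of_finite (f := fun i => h i x)
  obtain ⟨i₀, hi₀, hmax⟩ := Set.exists_max_image {i | h i x = ⨆ i, h i x} (fun i => h' i v)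
    (Set.toFinite _) ⟨i₁, hi₁⟩
  have hupper : ∀ c, h' i₀ v < c → ∀ᶠ q : Euc n × ℝ in 𝓝 x ×ˢ 𝓝[>] (0 : ℝ),
      ((⨆ i, h i (q.1 + q.2 • v)) - ⨆ i, h i q.1) / q.2 < c := by
    intro c hc
    have key : ∀ i, ∀ᶠ q : Euc n × ℝ in 𝓝 x ×ˢ 𝓝[>] (0 : ℝ),
        h i (q.1 + q.2 • v) = (⨆ i, h i (q.1 + q.2 • v)) →
          (h i (q.1 + q.2 • v) - h i q.1) / q.2 < c := by
      intro i
      by_cases hi : h i x = ⨆ i, h i x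
      · filter_upwards [eventually_quotient_lt_of_hasStrictFDerivAt (hh i)
          ((hmax i hi).trans_lt hc)] with q hq _ using hq
      · have hlt : h i x < h i₀ x := by
          rw [show h i₀ x = _ from hi₀]
          exact lt_of_le_of_ne (hle i x) hi
        have h1 := (((hh i).hasFDerivAt.continuousAt.tendsto).comp
          (tendsto_add_smul_prod x v)).eventually_lt
          (((hh i₀).hasFDerivAt.continuousAt.tendsto).comp (tendsto_add_smul_prod x v)) hlt
        filter_upwards [h1] with q hq heq
        exact absurd heq (hq.trans_le (hle i₀ _)).ne
    filter_upwards [eventually_all.2 key, eventually_prod_snd_pos x] with q hq hpos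
    obtain ⟨i, hi⟩ := exists_eq_ciSup_of_finite (f := fun i => h i (q.1 + q.2 • v))
    refine lt_of_le_of_lt ?_ (hq i hi)
    have := hle i q.1
    rw [← hi]
    gcongr
  refine ⟨h' i₀ v, tendsto_order.2 ⟨fun c hc => ?_, fun c hc => ?_⟩, hupper⟩
  · have h1 := ((hh i₀).hasFDerivAt.hasLineDerivAt v).tendsto_slope_zero_right
    filter_upwards [h1.eventually_const_lt hc, self_mem_nhdsWithin] with t ht hpos
    refine ht.trans_le ?_
    rw [smul_eq_mul, inv_mul_eq_div, show h i₀ x = _ from hi₀]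
    have hpos' : (0 : ℝ) < t := hpos
    have := hle i₀ (x + t • v)
    gcongr
  · have h1 : Tendsto (fun t : ℝ => (x, t)) (𝓝[>] 0) (𝓝 x ×ˢ 𝓝[>] (0 : ℝ)) :=
      tendsto_const_nhds.prodMk tendsto_id
    exact h1.eventually (hupper c hc)

/-- Regular directional derivatives pass through an expectation whose integrand is locally
Lipschitz with an integrable constant. The excess of the difference quotient over the derivative
has positive part tending to zero, so dominated convergence applies to that positive part, even
though the quotients themselves need not converge as the base point moves. -/
lemma HasRegularDirDeriv.integral {n : ℕ} {Ω : Type*} [MeasurableSpace Ω] {μ : Measure Ω}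
    {H : Euc n → Ω → ℝ} {x v : Euc n} {D : Ω → ℝ} (hint : ∀ y, Integrable (H y) μ)
    (hD : ∀ᵐ ω ∂μ, HasRegularDirDeriv (fun y => H y ω) x v (D ω))
    {U : Set (Euc n)} (hU : U ∈ 𝓝 x) {L : Ω → ℝ} (hL : Integrable L μ)
    (hLip : ∀ᵐ ω ∂μ, ∀ y ∈ U, ∀ z ∈ U, |H y ω - H z ω| ≤ L ω * ‖y - z‖) :
    HasRegularDirDeriv (fun y => ∫ ω, H y ω ∂μ) x v (∫ ω, D ω ∂μ) := by
  set Q : Euc n × ℝ → Ω → ℝ := fun q ω => (H (q.1 + q.2 • v) ω - H q.1 ω) / q.2 with hQ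
  have hQint : ∀ q, Integrable (Q q) μ := fun q => ((hint _).sub (hint _)).div_const _
  have hQeq : ∀ q : Euc n × ℝ,
      ((∫ ω, H (q.1 + q.2 • v) ω ∂μ) - ∫ ω, H q.1 ω ∂μ) / q.2 = ∫ ω, Q q ω ∂μ := fun q => by
    rw [← integral_sub (hint _) (hint _), ← integral_div]
  have hbound : ∀ᶠ q : Euc n × ℝ in 𝓝 x ×ˢ 𝓝[>] (0 : ℝ), ∀ᵐ ω ∂μ, |Q q ω| ≤ L ω * ‖v‖ := by
    filter_upwards [(tendsto_add_smul_prod x v).eventually hU, tendsto_fst.eventually hU,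
      eventually_prod_snd_pos x] with q h1 h2 hpos
    filter_upwards [hLip] with ω hω
    have := hω _ h1 _ h2
    rw [add_sub_cancel_left, norm_smul, Real.norm_eq_abs, abs_of_pos hpos] at this
    rw [hQ]
    simp only
    rw [abs_div, abs_of_pos hpos, div_le_iff₀ hpos]
    linarith
  have hline : Tendsto (fun t : ℝ => (x, t)) (𝓝[>] 0) (𝓝 x ×ˢ 𝓝[>] (0 : ℝ)) :=
    tendsto_const_nhds.prodMk tendsto_id
  have hLv : Integrable (fun ω => L ω * ‖v‖) μ := hL.mul_const _
  have hDlim : ∀ᵐ ω ∂μ, Tendsto (fun t : ℝ => Q (x, t) ω) (𝓝[>] 0) (𝓝 (D ω)) := by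
    filter_upwards [hD] with ω hω using hω.tendsto
  have hDm : AEStronglyMeasurable D μ :=
    aestronglyMeasurable_of_tendsto_ae (𝓝[>] (0 : ℝ)) (fun t => (hQint (x, t)).1) hDlim
  have hDbound : ∀ᵐ ω ∂μ, |D ω| ≤ L ω * ‖v‖ := by
    obtain ⟨u, hu⟩ := exists_seq_tendsto (𝓝[>] (0 : ℝ))
    obtain ⟨N, hN⟩ := eventually_atTop.1 ((hline.comp hu).eventually hbound)
    have hall : ∀ᵐ ω ∂μ, ∀ k, N ≤ k → |Q (x, u k) ω| ≤ L ω * ‖v‖ :=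
      ae_all_iff.2 fun k => by
        by_cases hk : N ≤ k
        · filter_upwards [hN k hk] with ω hω _ using hω
        · exact Eventually.of_forall fun ω h => absurd h hk
    filter_upwards [hall, hDlim] with ω h1 h2
    exact le_of_tendsto (h2.comp hu).abs (eventually_atTop.2 ⟨N, h1⟩)
  have hDint : Integrable D μ := hLv.mono' hDm hDbound
  refine ⟨?_, fun c hc => ?_⟩
  · have := tendsto_integral_filter_of_dominated_convergence (μ := μ) (l := 𝓝[>] (0 : ℝ))
      (F := fun t => Q (x, t)) (f := D) (fun ω => L ω * ‖v‖)
      (Eventually.of_forall fun t => (hQint (x, t)).1) (hline.eventually hbound) hLv hDlim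
    exact this.congr fun t => (hQeq (x, t)).symm
  · have hpos : Tendsto (fun q => ∫ ω, max (Q q ω - D ω) 0 ∂μ) (𝓝 x ×ˢ 𝓝[>] (0 : ℝ))
        (𝓝 (∫ _, (0 : ℝ) ∂μ)) := by
      refine tendsto_integral_filter_of_dominated_convergence (fun ω => L ω * ‖v‖ + |D ω|)
        (Eventually.of_forall fun q => ((hQint q).sub hDint).pos_part.1) ?_
        (hLv.add hDint.abs) ?_
      · filter_upwards [hbound] with q hq
        filter_upwards [hq] with ω hω
        rw [Real.norm_eq_abs, abs_of_nonneg (le_max_right _ _)]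
        have h1 := abs_le.1 hω
        have h2 := neg_abs_le (D ω)
        exact max_le (by linarith) (by linarith [abs_nonneg (Q q ω), abs_nonneg (D ω)])
      · filter_upwards [hD] with ω hω
        refine tendsto_order.2 ⟨fun b hb => Eventually.of_forall fun q =>
          hb.trans_le (le_max_right _ _), fun b hb => ?_⟩
        filter_upwards [hω.eventually_lt (D ω + b) (by linarith)] with q hq
        exact max_lt (by simp only [hQ]; linarith) hb
    rw [integral_zero] at hpos
    filter_upwards [hpos.eventually_lt_const (sub_pos.2 hc)] with q hq
    rw [hQeq q]
    have h1 : ∫ ω, (Q q ω - D ω) ∂μ ≤ ∫ ω, max (Q q ω - D ω) 0 ∂μ :=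
      integral_mono ((hQint q).sub hDint) ((hQint q).sub hDint).pos_part
        fun ω => le_max_left _ _
    rw [integral_sub (hQint q) hDint] at h1
    linarith

/-! ### Expectations as integrals of the distribution function -/

lemma integrable_deriv_of_monotone_of_bounded {ψ : ℝ → ℝ} (hψ : ContDiff ℝ 1 ψ)
    (hmono : Monotone ψ) {M : ℝ} (hM : ∀ y, |ψ y| ≤ M) : Integrable (deriv ψ) := by
  have hcont := hψ.continuous_deriv le_rfl
  refine integrable_of_intervalIntegral_norm_bounded (l := atTop) (a := fun r : ℝ => -r)
    (b := id) (2 * M) (fun r => (hcont.integrableOn_Icc).mono_set Ioc_subset_Icc_self)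
    tendsto_neg_atTop_atBot tendsto_id ?_
  refine Eventually.of_forall fun r => ?_
  have h1 : ∀ y, ‖deriv ψ y‖ = deriv ψ y := fun y => by
    rw [Real.norm_eq_abs, abs_of_nonneg hmono.deriv_nonneg]
  simp only [h1]
  rw [intervalIntegral.integral_deriv_eq_sub
    (fun y _ => (hψ.differentiable one_ne_zero).differentiableAt) (hcont.intervalIntegrable _ _)]
  have h2 := abs_le.1 (hM (id r))
  have h3 := abs_le.1 (hM (-r))
  linarith

/-- Integration by parts for `𝔼[ψ(G)]`: up to sign and to the constant `ψ(∞)`, which does not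
depend on `G`, it is the integral of the distribution function of `G` against `ψ'`. -/
lemma exists_forall_integral_comp_eq {Ω : Type*} [MeasurableSpace Ω] (μ : Measure Ω)
    [IsProbabilityMeasure μ] {ψ : ℝ → ℝ} (hψ : ContDiff ℝ 1 ψ)
    (hmono : Monotone ψ) {M : ℝ} (hM : ∀ y, |ψ y| ≤ M) :
    ∃ c : ℝ, ∀ G : Ω → ℝ, Measurable G →
      ∫ ω, ψ (G ω) ∂μ = c - ∫ η, μ.real {ω | G ω ≤ η} * deriv ψ η := by
  have hw := integrable_deriv_of_monotone_of_bounded hψ hmono hM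
  have hbdd : BddAbove (range ψ) := ⟨M, by rintro _ ⟨y, rfl⟩; exact (abs_le.1 (hM y)).2⟩
  refine ⟨⨆ y, ψ y, fun G hG => ?_⟩
  have htop := tendsto_atTop_ciSup hmono hbdd
  have hset : MeasurableSet {p : Ω × ℝ | G p.1 ≤ p.2} :=
    measurableSet_le (hG.comp measurable_fst) measurable_snd
  have hprod : Integrable (Function.uncurry fun (ω : Ω) (η : ℝ) =>
      {p : Ω × ℝ | G p.1 ≤ p.2}.indicator (fun p => deriv ψ p.2) (ω, η)) (μ.prod volume) := by
    have h1 : Integrable (fun p : Ω × ℝ => deriv ψ p.2) (μ.prod volume) := hw.comp_snd μ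
    exact h1.indicator hset
  have hswap := integral_integral_swap hprod
  have hleft : ∀ ω, ∫ η, {p : Ω × ℝ | G p.1 ≤ p.2}.indicator (fun p => deriv ψ p.2) (ω, η)
      = (⨆ y, ψ y) - ψ (G ω) := by
    intro ω
    rw [← integral_Ioi_of_hasDerivAt_of_tendsto'
      (fun y _ => ((hψ.differentiable one_ne_zero) y).hasDerivAt) hw.integrableOn htop,
      ← integral_Ici_eq_integral_Ioi, ← integral_indicator measurableSet_Ici]
    rfl
  have hright : ∀ η, ∫ ω, {p : Ω × ℝ | G p.1 ≤ p.2}.indicator (fun p => deriv ψ p.2) (ω, η) ∂μ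
      = μ.real {ω | G ω ≤ η} * deriv ψ η := by
    intro η
    have : (fun ω => {p : Ω × ℝ | G p.1 ≤ p.2}.indicator (fun p => deriv ψ p.2) (ω, η))
        = {ω | G ω ≤ η}.indicator fun _ => deriv ψ η := rfl
    rw [this]
    exact integral_indicator_const _ (hG measurableSet_Iic)
  simp only [hleft, hright] at hswap
  have hψG : Integrable (fun ω => ψ (G ω)) μ :=
    Integrable.of_bound (hψ.continuous.measurable.comp hG).aestronglyMeasurable M
      (Eventually.of_forall fun ω => hM _)
  rw [integral_sub (integrable_const _) hψG, integral_const, probReal_univ, one_smul] at hswap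
  linarith

lemma setIntegral_deriv_abs_lt {ψ : ℝ → ℝ} (hψ : ContDiff ℝ 1 ψ) {ε : ℝ} (hε : 0 < ε) :
    ∫ η in {η : ℝ | |η| < ε}, deriv ψ η = ψ ε - ψ (-ε) := by
  have hset : {η : ℝ | |η| < ε} = Ioo (-ε) ε := by ext η; simp [abs_lt]
  rw [hset, ← integral_Ioc_eq_integral_Ioo,
    ← intervalIntegral.integral_of_le (by linarith : -ε ≤ ε),
    intervalIntegral.integral_deriv_eq_sub
      (fun y _ => (hψ.differentiable one_ne_zero).differentiableAt)
      ((hψ.continuous_deriv le_rfl).intervalIntegrable _ _)]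

/-- A weighted integral bounded separately over the window `|η| < ε` and over the tail. -/
lemma neg_integral_mul_le {Δ w L : ℝ → ℝ} {ε r b : ℝ} (hw : ∀ η, 0 ≤ w η) (hwint : Integrable w)
    (hΔ : Integrable fun η => Δ η * w η) (hL : Integrable fun η => L η * w η)
    (htail : ∀ η, |Δ η| ≤ L η * r) (hwindow : ∀ η, |η| < ε → b ≤ Δ η) :
    -∫ η, Δ η * w η ≤
      r * (∫ η in {η : ℝ | ε ≤ |η|}, L η * w η) - b * ∫ η in {η : ℝ | |η| < ε}, w η := by
  have hm : MeasurableSet {η : ℝ | |η| < ε} := measurableSet_lt measurable_norm measurable_const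
  have hc : {η : ℝ | |η| < ε}ᶜ = {η : ℝ | ε ≤ |η|} := by ext; simp
  rw [← integral_add_compl hm hΔ, hc]
  have h1 : b * ∫ η in {η : ℝ | |η| < ε}, w η ≤ ∫ η in {η : ℝ | |η| < ε}, Δ η * w η := by
    rw [← integral_const_mul]
    exact setIntegral_mono_on (hwint.integrableOn.const_mul b) hΔ.integrableOn hm
      fun η hη => mul_le_mul_of_nonneg_right (hwindow η hη) (hw η)
  have h2 : -∫ η in {η : ℝ | ε ≤ |η|}, Δ η * w η ≤
      r * ∫ η in {η : ℝ | ε ≤ |η|}, L η * w η := by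
    rw [← integral_neg, ← integral_const_mul]
    refine integral_mono hΔ.neg.integrableOn (hL.const_mul r).integrableOn fun η => ?_
    have := mul_le_mul_of_nonneg_right (((neg_le_abs _).trans (htail η))) (hw η)
    simp only
    linarith
  linarith

/-! ### Reduction to a single scaled constraint -/

/-- The scaled max-constraint `max_j g_j(x, ξ) / τ_{0,j}`. -/
noncomputable def scaledMax {n d m : ℕ} (g : Fin m → Euc n → Euc d → ℝ) (τ : ℕ → Fin m → ℝ)
    (x : Euc n) (ξ : Euc d) : ℝ :=
  ⨆ j : Fin m, g j x ξ / τ 0 j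

namespace GeometricSmoothing

variable {m : ℕ} {φ : ℝ → ℝ → ℝ} {τ : ℕ → Fin m → ℝ} {τc : ℝ}

lemma param_eq (h : GeometricSmoothing φ τ τc) (k : ℕ) (j : Fin m) :
    τ k j = τc ^ k * τ 0 j := by
  induction k with
  | zero => simp
  | succ k ih => rw [h.step_eq, ih, pow_succ]; ring

/-- Homogeneity turns the smoothing functions of all constraints into the one function
`φ(·; τc ^ k)` of the scaled argument. -/
lemma smoothing_eq (h : GeometricSmoothing φ τ τc) (k : ℕ) (j : Fin m) (y : ℝ) :
    smoothing φ τ k j y = φ (y / τ 0 j) (τc ^ k) := by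
  have hpos := h.init_pos j
  rw [smoothing, h.param_eq, ← h.homogeneous (τ 0 j) (y / τ 0 j) (τc ^ k) hpos
    (pow_pos h.ratio_mem.1 k), mul_div_cancel₀ _ hpos.ne', mul_comm (τ 0 j)]

lemma base_eq (h : GeometricSmoothing φ τ τc) (k : ℕ) (j : Fin m) :
    (fun y => φ y (τc ^ k)) = fun y => smoothing φ τ k j (τ 0 j * y) := by
  ext y
  rw [h.smoothing_eq, mul_div_cancel_left₀ _ (h.init_pos j).ne']

lemma contDiff_base (h : GeometricSmoothing φ τ τc) (hφ : SmoothingBasic (smoothing φ τ))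
    (j : Fin m) (k : ℕ) : ContDiff ℝ 1 fun y => φ y (τc ^ k) := by
  rw [h.base_eq k j]
  exact (hφ.contDiff k j).comp (contDiff_const.mul contDiff_id)

lemma monotone_base (h : GeometricSmoothing φ τ τc) (hφ : SmoothingBasic (smoothing φ τ))
    (j : Fin m) (k : ℕ) : Monotone fun y => φ y (τc ^ k) := by
  rw [h.base_eq k j]
  exact (hφ.monotone k j).comp (monotone_mul_left_of_nonneg (h.init_pos j).le)

lemma exists_abs_base_le (h : GeometricSmoothing φ τ τc) (hφ : SmoothingBasic (smoothing φ τ))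
    (j : Fin m) (k : ℕ) : ∃ M, ∀ y, |φ y (τc ^ k)| ≤ M := by
  obtain ⟨M, -, hM⟩ := hφ.equibounded
  refine ⟨M, fun y => ?_⟩
  rw [congrFun (h.base_eq k j) y]
  exact hM _ _ _

lemma exists_abs_deriv_base_le (h : GeometricSmoothing φ τ τc)
    (hφ' : SmoothingDerivatives (smoothing φ τ)) (j : Fin m) (k : ℕ) :
    ∃ M, ∀ y, |deriv (fun y => φ y (τc ^ k)) y| ≤ M := by
  obtain ⟨M, hM⟩ := hφ'.bounded k j
  refine ⟨τ 0 j * M, fun y => ?_⟩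
  rw [h.base_eq k j, deriv_comp_mul_left (τ 0 j) (smoothing φ τ k j) y, smul_eq_mul, abs_mul,
    abs_of_pos (h.init_pos j)]
  exact mul_le_mul_of_nonneg_left (hM _) (h.init_pos j).le

lemma iSup_smoothing_eq (h : GeometricSmoothing φ τ τc) (hφ : SmoothingBasic (smoothing φ τ))
    [Nonempty (Fin m)] (k : ℕ) (a : Fin m → ℝ) :
    ⨆ j, smoothing φ τ k j (a j) = φ (⨆ j, a j / τ 0 j) (τc ^ k) := by
  obtain ⟨j₀⟩ := id ‹Nonempty (Fin m)›
  simp only [h.smoothing_eq]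
  exact ((h.monotone_base hφ j₀ k).map_ciSup_of_continuousAt
    (h.contDiff_base hφ j₀ k).continuous.continuousAt (Set.finite_range _).bddAbove).symm

end GeometricSmoothing

lemma abs_iSup_sub_iSup_le_sum {ι : Type*} [Fintype ι] [Nonempty ι] (a b : ι → ℝ) :
    |(⨆ i, a i) - ⨆ i, b i| ≤ ∑ i, |a i - b i| := by
  have key : ∀ a b : ι → ℝ, (⨆ i, a i) - ⨆ i, b i ≤ ∑ i, |a i - b i| := by
    intro a b
    obtain ⟨i, hi⟩ := exists_eq_ciSup_of_finite (f := a)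
    have h1 : b i ≤ ⨆ i, b i := le_ciSup (Set.finite_range b).bddAbove i
    have h2 : |a i - b i| ≤ ∑ i, |a i - b i| :=
      Finset.single_le_sum (f := fun i => |a i - b i|) (fun i _ => abs_nonneg _)
        (Finset.mem_univ i)
    rw [← hi]
    linarith [le_abs_self (a i - b i)]
  refine abs_le.2 ⟨?_, key a b⟩
  have := key b a
  simp only [abs_sub_comm (b _)] at this
  linarith

lemma measurable_constraint {n d m : ℕ} {g : Fin m → Euc n → Euc d → ℝ}
    (hg : ∀ j, ContDiff ℝ 1 (fun q : Euc n × Euc d => g j q.1 q.2)) (j : Fin m) (x : Euc n) :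
    Measurable (g j x) :=
  ((hg j).continuous.comp (Continuous.prodMk_right x)).measurable

lemma measurable_scaledMax {n d m : ℕ} {g : Fin m → Euc n → Euc d → ℝ} {τ : ℕ → Fin m → ℝ}
    (hg : ∀ j, ContDiff ℝ 1 (fun q : Euc n × Euc d => g j q.1 q.2)) (x : Euc n) :
    Measurable (scaledMax g τ x) :=
  Measurable.iSup fun j => (measurable_constraint hg j x).div_const _

lemma approxProb_eq_integral_scaledMax {n d m : ℕ} [Nonempty (Fin m)] {P : Measure (Euc d)}
    {g : Fin m → Euc n → Euc d → ℝ} {φ : ℝ → ℝ → ℝ} {τ : ℕ → Fin m → ℝ} {τc : ℝ}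
    (hgeom : GeometricSmoothing φ τ τc)
    (hφ : SmoothingBasic (smoothing φ τ)) (k : ℕ) (x : Euc n) :
    approxProb P g φ τ k x = ∫ ξ, φ (scaledMax g τ x ξ) (τc ^ k) ∂P := by
  simp only [approxProb, hgeom.iSup_smoothing_eq hφ, scaledMax]

section Problem

variable {n d m : ℕ} [Nonempty (Fin m)] {P : Measure (Euc d)} [IsProbabilityMeasure P]
  {Ξ : Set (Euc d)} {g : Fin m → Euc n → Euc d → ℝ} {φ : ℝ → ℝ → ℝ} {τ : ℕ → Fin m → ℝ}
  {τc : ℝ} {S : Set (Euc n)}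

lemma exists_forall_approxProb_eq
    (hg : ∀ j, ContDiff ℝ 1 (fun q : Euc n × Euc d => g j q.1 q.2))
    (hgeom : GeometricSmoothing φ τ τc) (hφ : SmoothingBasic (smoothing φ τ)) (k : ℕ) :
    ∃ c : ℝ, ∀ x, approxProb P g φ τ k x =
      c - ∫ η, scaledCDF P g τ x η * deriv (fun y => φ y (τc ^ k)) η := by
  obtain ⟨j⟩ := id ‹Nonempty (Fin m)›
  obtain ⟨M, hM⟩ := hgeom.exists_abs_base_le hφ j k
  obtain ⟨c, hc⟩ := exists_forall_integral_comp_eq P (hgeom.contDiff_base hφ j k)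
    (hgeom.monotone_base hφ j k) hM
  refine ⟨c, fun x => ?_⟩
  rw [approxProb_eq_integral_scaledMax hgeom hφ, hc _ (measurable_scaledMax hg x)]
  rfl

/-- The difference of two values of `p̂_k` is minus the difference of the distribution functions,
integrated against `φ'(·; τc ^ k)`. -/
lemma approxProb_sub_approxProb
    (hg : ∀ j, ContDiff ℝ 1 (fun q : Euc n × Euc d => g j q.1 q.2))
    (hgeom : GeometricSmoothing φ τ τc) (hφ : SmoothingBasic (smoothing φ τ)) (k : ℕ)
    (x y : Euc n) :
    Integrable (fun η => (scaledCDF P g τ y η - scaledCDF P g τ x η) *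
        deriv (fun y => φ y (τc ^ k)) η) ∧
      approxProb P g φ τ k y - approxProb P g φ τ k x =
        -∫ η, (scaledCDF P g τ y η - scaledCDF P g τ x η) *
          deriv (fun y => φ y (τc ^ k)) η := by
  obtain ⟨c, hc⟩ := exists_forall_approxProb_eq (P := P) hg hgeom hφ k
  obtain ⟨j⟩ := ‹Nonempty (Fin m)›
  obtain ⟨M, hM⟩ := hgeom.exists_abs_base_le hφ j k
  have hw := integrable_deriv_of_monotone_of_bounded (hgeom.contDiff_base hφ j k)
    (hgeom.monotone_base hφ j k) hM
  have hF : ∀ z, Integrable fun η => scaledCDF P g τ z η *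
      deriv (fun y => φ y (τc ^ k)) η := by
    intro z
    have hmono : Monotone (scaledCDF P g τ z) := fun a b hab =>
      measureReal_mono fun ξ (hξ : _ ≤ a) => hξ.trans hab
    refine hw.bdd_mul (c := 1) hmono.measurable.aestronglyMeasurable
      (Eventually.of_forall fun η => ?_)
    rw [Real.norm_eq_abs, scaledCDF, abs_of_nonneg measureReal_nonneg]
    exact measureReal_le_one
  simp only [sub_mul]
  refine ⟨(hF y).sub (hF x), ?_⟩
  rw [hc, hc, integral_sub (hF y) (hF x)]
  ring

lemma violationProb_eq_one_sub_scaledCDF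
    (hg : ∀ j, ContDiff ℝ 1 (fun q : Euc n × Euc d => g j q.1 q.2))
    (hτ : ∀ j, 0 < τ 0 j) (x : Euc n) :
    violationProb P g x = 1 - scaledCDF P g τ x 0 := by
  have hm : MeasurableSet {ξ | scaledMax g τ x ξ ≤ 0} :=
    measurable_scaledMax hg x measurableSet_Iic
  have hset : {ξ | ¬ ∀ j, g j x ξ ≤ 0} = {ξ | scaledMax g τ x ξ ≤ 0}ᶜ := by
    ext ξ
    have : scaledMax g τ x ξ ≤ 0 ↔ ∀ j, g j x ξ ≤ 0 := by
      rw [scaledMax, ciSup_le_iff (Set.finite_range _).bddAbove]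
      exact forall_congr' fun j => by rw [div_le_iff₀ (hτ j), zero_mul]
    simp [this]
  rw [violationProb, hset, probReal_compl_eq_one_sub hm]
  rfl

/-! ### Stationarity of the approximating problems -/

/-- `p̂_k` is regular at the points of `S`: its integrand is a maximum of `C¹` functions, locally
Lipschitz with an integrable constant. -/
lemma exists_hasRegularDirDeriv_approxProb (hΞ : ∀ᵐ ξ ∂P, ξ ∈ Ξ)
    (hg : ∀ j, ContDiff ℝ 1 (fun q : Euc n × Euc d => g j q.1 q.2))
    (hgreg : ConstraintRegularity P Ξ g S) (hφ : SmoothingBasic (smoothing φ τ))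
    (hφ' : SmoothingDerivatives (smoothing φ τ)) (k : ℕ) {x : Euc n} (hx : x ∈ S) (v : Euc n) :
    ∃ D, HasRegularDirDeriv (approxProb P g φ τ k) x v D := by
  obtain ⟨B, -, hB⟩ := hφ.equibounded
  choose U hU L hL hLip using fun j => hgreg.locallyLipschitz j x hx
  choose M hM using hφ'.bounded k
  have hreg : ∀ ξ, ∃ D,
      HasRegularDirDeriv (fun y => ⨆ j, smoothing φ τ k j (g j y ξ)) x v D := by
    intro ξ
    refine exists_hasRegularDirDeriv_iSup (fun j => ?_) v
      (h' := fun j => fderiv ℝ (fun y => smoothing φ τ k j (g j y ξ)) x)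
    have hcd : ContDiff ℝ 1 fun y => smoothing φ τ k j (g j y ξ) :=
      (hφ.contDiff k j).comp ((hg j).comp (contDiff_id.prodMk contDiff_const))
    exact hcd.contDiffAt.hasStrictFDerivAt one_ne_zero
  choose D hD using hreg
  refine ⟨∫ ξ, D ξ ∂P, HasRegularDirDeriv.integral (fun y => ?_) (Eventually.of_forall hD)
    (iInter_mem.2 hU) (L := fun ξ => ∑ j, M j * L j ξ)
    (integrable_finsetSum _ fun j _ => (hL j).const_mul _) ?_⟩
  · refine Integrable.of_bound (Measurable.aestronglyMeasurable (Measurable.iSup fun j =>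
      (hφ.contDiff k j).continuous.measurable.comp (measurable_constraint hg j y))) B
      (Eventually.of_forall fun ξ => ?_)
    obtain ⟨j, hj⟩ := exists_eq_ciSup_of_finite (f := fun j => smoothing φ τ k j (g j y ξ))
    rw [← hj]
    exact hB _ _ _
  · filter_upwards [hΞ] with ξ hξ y hy z hz
    refine (abs_iSup_sub_iSup_le_sum _ _).trans ?_
    rw [Finset.sum_mul]
    refine Finset.sum_le_sum fun j _ => ?_
    have h1 := Convex.norm_image_sub_le_of_norm_deriv_le (f := smoothing φ τ k j) (C := M j)
      (fun w _ => ((hφ.contDiff k j).differentiable one_ne_zero) w) (fun w _ => hM j w)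
      convex_univ (mem_univ (g j z ξ)) (mem_univ (g j y ξ))
    have h2 := hLip j ξ hξ y (mem_iInter.1 hy j) z (mem_iInter.1 hz j)
    have h3 : 0 ≤ M j := (abs_nonneg _).trans (hM j 0)
    rw [Real.norm_eq_abs, Real.norm_eq_abs] at h1
    rw [mul_assoc]
    exact h1.trans (mul_le_mul_of_nonneg_left h2 h3)

/-- A Clarke stationary point at which `h` is regular admits no first-order descent along
segments inside `S`. -/
lemma IsClarkeStationary.nonneg_of_hasRegularDirDeriv {h : Euc n → ℝ} {x y : Euc n} {D : ℝ}
    (hx : IsClarkeStationary h S x) (hy : y ∈ S) (hD : HasRegularDirDeriv h x (y - x) D) :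
    0 ≤ D := by
  obtain ⟨ζ, hζ, w, hw, hsum⟩ := hx.2
  have h1 : inner ℝ ζ (y - x) ≤ D :=
    EReal.coe_le_coe_iff.1 ((hζ (y - x)).trans hD.clarkeDirDeriv_le)
  have h2 := hw.2 y hy
  have h3 : ζ = -w := eq_neg_of_add_eq_zero_left hsum
  rw [h3, inner_neg_left] at h1
  linarith

/-- First-order upper bound for `p̂_k` along a segment in `S`: if `F(·, η)` increases along the
segment at rate at least `b` for `|η| < ε`, the directional derivative of `p̂_k` is at most
`-b` times the mass of `φ'(·; τc ^ k)` in the window, plus the tail weighted by `L_F`. -/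
lemma dirDeriv_approxProb_le
    (hg : ∀ j, ContDiff ℝ 1 (fun q : Euc n × Euc d => g j q.1 q.2))
    (hgeom : GeometricSmoothing φ τ τc) (hφ : SmoothingBasic (smoothing φ τ))
    (hφ' : SmoothingDerivatives (smoothing φ τ)) {LF : ℝ → ℝ}
    (hF : CDFRegularity (scaledCDF P g τ) S LF) (hS : Convex ℝ S) (k : ℕ) {x y : Euc n}
    (hx : x ∈ S) (hy : y ∈ S) {D b ε : ℝ} (hε : 0 < ε)
    (hD : HasRegularDirDeriv (approxProb P g φ τ k) x (y - x) D)
    (hwindow : ∀ᶠ t : ℝ in 𝓝[>] 0, ∀ η, |η| < ε →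
      t * b ≤ scaledCDF P g τ (x + t • (y - x)) η - scaledCDF P g τ x η) :
    D ≤ ‖y - x‖ * (∫ η in {η : ℝ | ε ≤ |η|}, LF η * deriv (fun y => φ y (τc ^ k)) η)
      - b * (φ ε (τc ^ k) - φ (-ε) (τc ^ k)) := by
  obtain ⟨j⟩ := id ‹Nonempty (Fin m)›
  have hcd := hgeom.contDiff_base hφ j k
  have hmono := hgeom.monotone_base hφ j k
  obtain ⟨M, hM⟩ := hgeom.exists_abs_base_le hφ j k
  obtain ⟨M', hM'⟩ := hgeom.exists_abs_deriv_base_le hφ' j k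
  have hLw : Integrable fun η => LF η * deriv (fun y => φ y (τc ^ k)) η :=
    hF.integrable.mul_bdd (c := M') (hcd.continuous_deriv le_rfl).aestronglyMeasurable
      (Eventually.of_forall hM')
  refine le_of_tendsto hD.tendsto ?_
  filter_upwards [hwindow, Ioc_mem_nhdsGT (zero_lt_one' ℝ)] with t ht ht01
  have hmem : x + t • (y - x) ∈ S := hS.add_smul_sub_mem hx hy ⟨ht01.1.le, ht01.2⟩
  obtain ⟨hint, heq⟩ := approxProb_sub_approxProb (P := P) hg hgeom hφ k x (x + t • (y - x))
  have hle := neg_integral_mul_le (fun η => hmono.deriv_nonneg)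
    (integrable_deriv_of_monotone_of_bounded hcd hmono hM) hint hLw
    (r := t * ‖y - x‖) (fun η => ?_) ht
  · rw [div_le_iff₀ ht01.1, heq]
    refine hle.trans_eq ?_
    rw [setIntegral_deriv_abs_lt hcd hε]
    ring
  · refine (hF.lipschitz η _ hmem _ hx).trans_eq ?_
    rw [add_sub_cancel_left, norm_smul, Real.norm_eq_abs, abs_of_pos ht01.1]

end Problem

/-! ### Passage to the limit -/

lemma convex_feasibleSet {n : ℕ} {X : Set (Euc n)} (hX : Convex ℝ X) {f : Euc n → ℝ}
    (hf : QuasiconvexOn ℝ univ f) (ν : ℝ) : Convex ℝ (feasibleSet X f ν) := by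
  have h : feasibleSet X f ν = X ∩ {x ∈ univ | f x ≤ ν} := by ext; simp [feasibleSet]
  rw [h]
  exact hX.inter (hf ν)

end ChanceSmoothing

theorem mainTheorem2 {n d m : ℕ} (hm : 0 < m)
    -- the deterministic data
    (X : Set (ChanceSmoothing.Euc n)) (hXne : X.Nonempty) (hXclosed : IsClosed X)
    (hXconvex : Convex ℝ X)
    (f : ChanceSmoothing.Euc n → ℝ) (hfcont : Continuous f) (hfqc : QuasiconvexOn ℝ univ f)
    (ν : ℝ)
    -- the distribution of the random vector, supported on `Ξ`, and the constraint functions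
    (P : Measure (ChanceSmoothing.Euc d)) [IsProbabilityMeasure P]
    (Ξ : Set (ChanceSmoothing.Euc d)) (hΞ : ∀ᵐ ξ ∂P, ξ ∈ Ξ)
    (g : Fin m → ChanceSmoothing.Euc n → ChanceSmoothing.Euc d → ℝ)
    (hg : ∀ j, ContDiff ℝ 1
      (fun q : ChanceSmoothing.Euc n × ChanceSmoothing.Euc d => g j q.1 q.2))
    -- the smoothing function, the smoothing parameters and the Lipschitz modulus of the CDF
    (φ : ℝ → ℝ → ℝ) (τ : ℕ → Fin m → ℝ) (τc : ℝ) (LF : ℝ → ℝ)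
    -- the assumptions
    (hSne : (ChanceSmoothing.feasibleSet X f ν).Nonempty)
    (hScompact : IsCompact (ChanceSmoothing.feasibleSet X f ν))
    (hgreg : ChanceSmoothing.ConstraintRegularity P Ξ g (ChanceSmoothing.feasibleSet X f ν))
    (hφbasic : ChanceSmoothing.SmoothingBasic (ChanceSmoothing.smoothing φ τ))
    (hφderiv : ChanceSmoothing.SmoothingDerivatives (ChanceSmoothing.smoothing φ τ))
    (hgeom : ChanceSmoothing.GeometricSmoothing φ τ τc)
    (hF : ChanceSmoothing.CDFRegularity (ChanceSmoothing.scaledCDF P g τ)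
      (ChanceSmoothing.feasibleSet X f ν) LF)
    (htail : ChanceSmoothing.TailCondition φ τc LF)
    -- a sequence of stationary points of the approximating problems
    (x : ℕ → ChanceSmoothing.Euc n)
    (hx : ∀ k, ChanceSmoothing.IsClarkeStationary (ChanceSmoothing.approxProb P g φ τ k)
      (ChanceSmoothing.feasibleSet X f ν) (x k)) :
    ∀ xbar : ChanceSmoothing.Euc n, MapClusterPt xbar atTop x →
      xbar ∈ ChanceSmoothing.feasibleSet X f ν ∧
      DifferentiableAt ℝ (ChanceSmoothing.violationProb P g) xbar ∧
      (0 : ChanceSmoothing.Euc n) ∈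
        ({gradient (ChanceSmoothing.violationProb P g) xbar} : Set (ChanceSmoothing.Euc n)) +
          ChanceSmoothing.normalCone (ChanceSmoothing.feasibleSet X f ν) xbar := by
  obtain ⟨ε, hεpos, -, hε0, htail0, hmass⟩ := htail
  have : Nonempty (Fin m) := Fin.pos_iff_nonempty.1 hm
  intro xbar hxbar
  set S := ChanceSmoothing.feasibleSet X f ν with hSdef
  have hS : Convex ℝ S := ChanceSmoothing.convex_feasibleSet hXconvex hfqc ν
  obtain ⟨s, hs, hlim⟩ := hxbar.tendsto_subseq
  have hxbarS : xbar ∈ S := hScompact.isClosed.mem_of_tendsto hlim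
    (Eventually.of_forall fun k => (hx (s k)).1)
  -- `F` is strictly differentiable at `(xbar, 0)`; `A` is its partial derivative in `x`.
  obtain ⟨θ, hθ, Xbar, hXbar, hSX, hcd⟩ := hF.contDiffOn
  have hat : ContDiffAt ℝ 1 (fun q : ChanceSmoothing.Euc n × ℝ =>
      ChanceSmoothing.scaledCDF P g τ q.1 q.2) (xbar, 0) :=
    hcd.contDiffAt ((hXbar.prod isOpen_Ioo).mem_nhds ⟨hSX hxbarS, by simpa using hθ⟩)
  have hstrict := hat.hasStrictFDerivAt one_ne_zero
  set A' := fderiv ℝ (fun q : ChanceSmoothing.Euc n × ℝ =>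
      ChanceSmoothing.scaledCDF P g τ q.1 q.2) (xbar, 0) with hA'
  set A : ChanceSmoothing.Euc n →L[ℝ] ℝ :=
    A'.comp (ContinuousLinearMap.inl ℝ (ChanceSmoothing.Euc n) ℝ) with hA
  have hp : HasFDerivAt (ChanceSmoothing.violationProb P g) (-A) xbar := by
    have h1 : HasFDerivAt (fun x => ChanceSmoothing.scaledCDF P g τ x 0) A xbar :=
      HasFDerivAt.comp (g := fun q : ChanceSmoothing.Euc n × ℝ =>
        ChanceSmoothing.scaledCDF P g τ q.1 q.2) (f := fun e => (e, (0 : ℝ))) xbar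
        hstrict.hasFDerivAt (hasFDerivAt_prodMk_left xbar (0 : ℝ))
    have h2 := h1.const_sub 1
    rwa [show (fun x => 1 - ChanceSmoothing.scaledCDF P g τ x 0) =
      ChanceSmoothing.violationProb P g from funext fun x =>
        (ChanceSmoothing.violationProb_eq_one_sub_scaledCDF hg hgeom.init_pos x).symm] at h2
  have key : ∀ y ∈ S, A (y - xbar) ≤ 0 := by
    intro y hy
    have hv : Tendsto (fun k => y - x (s k)) atTop (𝓝 (y - xbar)) := tendsto_const_nhds.sub hlim
    have hAv : Tendsto (fun k => A (y - x (s k))) atTop (𝓝 (A (y - xbar))) :=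
      (A.continuous.tendsto _).comp hv
    -- The first-order bound holds up to an error `δ * ‖y - xbar‖` for every `δ > 0`.
    have hδ : ∀ δ : ℝ, 0 < δ → A (y - xbar) ≤ δ * ‖y - xbar‖ := by
      intro δ hδ
      have hbound : ∀ᶠ k in atTop, 0 ≤
          ‖y - x (s k)‖ * (∫ η in {η : ℝ | ε (s k) ≤ |η|},
            LF η * deriv (fun y => φ y (τc ^ s k)) η)
          - (A (y - x (s k)) - δ * ‖y - x (s k)‖) *
            (φ (ε (s k)) (τc ^ s k) - φ (-ε (s k)) (τc ^ s k)) := by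
        obtain ⟨r, hr, hball⟩ := Metric.eventually_nhds_iff.1 (hstrict.isLittleO.def hδ)
        have h1 : ∀ᶠ k in atTop, dist (x (s k)) xbar < r :=
          hlim.eventually (Metric.ball_mem_nhds xbar hr)
        have h2 : ∀ᶠ k in atTop, ε (s k) < r :=
          (hε0.comp hs.tendsto_atTop).eventually_lt_const hr
        filter_upwards [h1, h2] with k hk1 hk2
        obtain ⟨D, hD⟩ := ChanceSmoothing.exists_hasRegularDirDeriv_approxProb hΞ hg hgreg
          hφbasic hφderiv (s k) (hx (s k)).1 (y - x (s k))
        refine ((hx (s k)).nonneg_of_hasRegularDirDeriv hy hD).trans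
          (ChanceSmoothing.dirDeriv_approxProb_le hg hgeom hφbasic hφderiv hF hS (s k)
            (hx (s k)).1 hy (hεpos _) hD ?_)
        have h3 : Tendsto (fun t : ℝ => x (s k) + t • (y - x (s k))) (𝓝[>] 0) (𝓝 (x (s k))) := by
          have : Tendsto (fun t : ℝ => x (s k) + t • (y - x (s k))) (𝓝 0)
              (𝓝 (x (s k) + (0 : ℝ) • (y - x (s k)))) := Continuous.tendsto (by fun_prop) _
          rw [zero_smul, add_zero] at this
          exact this.mono_left nhdsWithin_le_nhds
        filter_upwards [h3.eventually (Metric.isOpen_ball.mem_nhds hk1), self_mem_nhdsWithin]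
          with t ht (htpos : 0 < t) η hη
        have hη' : |η| < r := hη.trans hk2
        have h4 := @hball ((x (s k) + t • (y - x (s k)), η), (x (s k), η)) (by
          rw [Prod.dist_eq, Prod.dist_eq, Prod.dist_eq]
          simp only [Real.dist_eq, sub_zero]
          exact max_lt (max_lt ht hη') (max_lt hk1 hη'))
        have h5 : ((x (s k) + t • (y - x (s k)), η) : ChanceSmoothing.Euc n × ℝ) - (x (s k), η)
            = t • ContinuousLinearMap.inl ℝ (ChanceSmoothing.Euc n) ℝ (y - x (s k)) := by
          ext <;> simp
        rw [h5, map_smul, norm_smul, ← ContinuousLinearMap.comp_apply, ← hA, smul_eq_mul,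
          Real.norm_eq_abs, Real.norm_eq_abs, abs_of_pos htpos, ContinuousLinearMap.inl_apply,
          Prod.norm_mk, norm_zero, max_eq_left (norm_nonneg _)] at h4
        linarith [(abs_le.1 h4).1]
      have hlimit := (hv.norm.mul (htail0.comp hs.tendsto_atTop)).sub
        ((hAv.sub (hv.norm.const_mul δ)).mul (hmass.comp hs.tendsto_atTop))
      have := ge_of_tendsto hlimit hbound
      linarith
    by_contra! hpos
    have hn : 0 < ‖y - xbar‖ + 1 := by positivity
    have h1 := hδ (A (y - xbar) / (‖y - xbar‖ + 1)) (div_pos hpos hn)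
    rw [div_mul_eq_mul_div, le_div_iff₀ hn] at h1
    linarith
  refine ⟨hxbarS, hp.differentiableAt, gradient (ChanceSmoothing.violationProb P g) xbar,
    rfl, -gradient (ChanceSmoothing.violationProb P g) xbar, ⟨hxbarS, fun y hy => ?_⟩,
    add_neg_cancel _⟩
  rw [inner_neg_left, gradient, hp.fderiv, InnerProductSpace.toDual_symm_apply,
    neg_apply, neg_neg]
  exact key y hy
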